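/- Let $\Bbbk$ be a field and let $P$ be a finite poset. Let $L(P)$ be the lattice of poset ideals (down-closed subsets) of $P$ ordered by inclusion, let $S=\Bbbk[x_\alpha:\alpha\in L(P)]$, let $I_{L(P)}\subset S$ be the ideal generated by the binomials $x_\alpha x_\beta-x_{\alpha\cap\beta}x_{\alpha\cup\beta}$ for incomparable $\alpha,\beta\in L(P)$, and let $\Bbbk[P]=S/I_{L(P)}$ be the Hibi ring of $P$. Let $C=\{c_1<\cdots<c_\ell\}$ be a (possibly empty) chain of $P$, let $C_i=\{c_1,\dots,c_i\}$ for $0\le i\le \ell$ and $\mathfrak p(C)=\{C_0,\dots,C_\ell\}$, let $m\ge 0$ be an integer, and let $f_C:\mathfrak p(C)\to\{0,\dots,m\}$ be a map. Grade $S$ by $\mathbb Z^{m+1}$ by setting $\deg_{f_C}(x_\alpha)=\mathbf e_{f_C(\alpha\cap C)}$, where $\mathbf e_0,\dots,\mathbf e_m$ are the unit vectors; the ideal $I_{L(P)}$ is homogeneous for this grading. For a homogeneous ideal $I$ of $S$, the multigraded Hilbert series of $S/I$ is $\mathrm{HS}(S/I;\mathbf t)=\sum_{\mathbf a}\dim_\Bbbk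 (S/I)_{\mathbf a}\,\mathbf t^{\mathbf a}$ with $\mathbf t=(t_0,\dots,t_m)$, its $\mathcal K$-polynomial is the polynomial $\mathcal K(S/I;\mathbf t)=\mathrm{HS}(S/I;\mathbf t)\prod_{\alpha\in L(P)}(1-\mathbf t^{\deg_{f_C}(x_\alpha)})\in\mathbb Z[\mathbf t]$, and its multidegree polynomial $\mathcal C(S/I;\mathbf t)$ is the sum of all terms of total degree $\operatorname{codim}(S/I)=\dim S-\dim S/I$ in $\mathcal K(S/I;1-t_0,\dots,1-t_m)$. Then $$\mathcal C(\Bbbk[P];\mathbf t)=\sum_{\mathcal M}\mathbf t^{\deg_{f_C}(\mathcal M^c)},$$ where $\mathcal M$ runs over the maximal chains of $L(P)$, $\mathcal M^c=L(P)\setminus\mathcal M$, and $\deg_{f_C}(\mathcal M^c)=\deg_{f_C}\bigl(\prod_{\alpha\in\mathcal M^c}x_\alpha\bigr)=\sum_{\alpha\in\mathcal M^c}\deg_{f_C}(x_\alpha)$. In particular, for $m=0$ the multidegree polynomial consists of exactly one term, $\mathcal C(\Bbbk[P];t_0)=N\,t_0^{\operatorname{codim}\Bbbk[P]}$, where $N\ge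 1$ is the number of maximal chains of $L(P)$; and $N$ is the degree of $\Bbbk[P]$ as a standard $\mathbb Z$-graded ring, that is, $N$ is $(\dim\Bbbk[P]-1)!$ times the leading coefficient of its Hilbert polynomial, which has degree $\dim \Bbbk[P]-1$. -/

import Mathlib

namespace HibiMultidegree

open MvPolynomial

section Graded

variable {σ τ k : Type*} [Field k]

/-- `I` is a homogeneous ideal of `S = k[x_i : i ∈ σ]` graded by `deg x_i = w i`: it contains all
homogeneous components of its elements. -/
def IsHomogeneousIdeal {A : Type*} [AddCommMonoid A] (w : σ → A)
    (I : Ideal (MvPolynomial σ k)) : Prop :=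
  ∀ p ∈ I, ∀ a : A, weightedHomogeneousComponent w a p ∈ I

/-- The multigraded Hilbert function `a ↦ dim_k (S/I)_a` of `S/I`, where `S = k[x_i : i ∈ σ]` is
graded by `deg x_i = w i` and `(S/I)_a` is the image of `S_a` in `S/I`. -/
noncomputable def hilbertFunction {A : Type*} [AddCommMonoid A] (w : σ → A)
    (I : Ideal (MvPolynomial σ k)) (a : A) : ℕ :=
  Module.finrank k
    ((weightedHomogeneousSubmodule k w a).map (Ideal.Quotient.mkₐ k I).toLinearMap)

/-- The multigraded Hilbert series `∑_a dim_k (S/I)_a t^a`. -/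
noncomputable def hilbertSeries (w : σ → (τ →₀ ℕ)) (I : Ideal (MvPolynomial σ k)) :
    MvPowerSeries τ ℤ :=
  fun a => (hilbertFunction w I a : ℤ)

/-- `K ∈ ℤ[t]` is the K-polynomial of `S/I`: `K = HS(S/I; t) · ∏_i (1 - t^{deg x_i})`
(for finitely many variables). -/
def IsKPolynomial (w : σ → (τ →₀ ℕ)) (I : Ideal (MvPolynomial σ k))
    (K : MvPolynomial τ ℤ) : Prop :=
  (K : MvPowerSeries τ ℤ) =
    hilbertSeries w I * ∏ᶠ i : σ, (1 - MvPowerSeries.monomial (w i) (1 : ℤ))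

/-- The K-polynomial is unique. -/
theorem IsKPolynomial.unique {w : σ → (τ →₀ ℕ)} {I : Ideal (MvPolynomial σ k)}
    {K K' : MvPolynomial τ ℤ} (h : IsKPolynomial w I K) (h' : IsKPolynomial w I K') : K = K' :=
  MvPolynomial.coe_injective _ _ (h.trans h'.symm)

/-- `S/I` has codimension `d`, that is, `dim S - dim S/I = d` (Krull dimensions). -/
def HasCodim (I : Ideal (MvPolynomial σ k)) (d : ℕ) : Prop :=
  ringKrullDim (MvPolynomial σ k ⧸ I) + (d : WithBot ℕ∞) = ringKrullDim (MvPolynomial σ k)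

/-- `C ∈ ℤ[t]` is the multidegree polynomial of `S/I`: the sum of all terms of total degree
`codim (S/I)` in `K(S/I; 1 - t)`. -/
def IsMultidegreePolynomial (w : σ → (τ →₀ ℕ)) (I : Ideal (MvPolynomial σ k))
    (C : MvPolynomial τ ℤ) : Prop :=
  ∃ (K : MvPolynomial τ ℤ) (d : ℕ), IsKPolynomial w I K ∧ HasCodim I d ∧
    C = homogeneousComponent d (aeval (fun j : τ => (1 - X j : MvPolynomial τ ℤ)) K)

/-- `e` is the degree (multiplicity) of the standard `ℤ`-graded ring `R = S/I` (`deg x_i = 1`) of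
positive dimension: `R` has a Hilbert polynomial, of degree `dim R - 1`, and `e` is `(dim R - 1)!`
times its leading coefficient. -/
def HasDegree (I : Ideal (MvPolynomial σ k)) (e : ℕ) : Prop :=
  ∃ p : Polynomial ℚ,
    (∀ᶠ q : ℕ in Filter.atTop,
      p.eval (q : ℚ) = (hilbertFunction (fun _ : σ => (1 : ℕ)) I q : ℚ)) ∧
    ringKrullDim (MvPolynomial σ k ⧸ I) = ((p.natDegree + 1 : ℕ) : WithBot ℕ∞) ∧
    (e : ℚ) = (p.natDegree.factorial : ℚ) * p.leadingCoeff

end Graded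

section Hibi

/-- The ideal `I_L` generated by `x_α x_β - x_{α ∧ β} x_{α ∨ β}` for incomparable `α, β ∈ L`. -/
noncomputable def hibiIdeal (k : Type*) [Field k] (L : Type*) [Lattice L] : Ideal (MvPolynomial L k) :=
  Ideal.span {g | ∃ α β : L, ¬ α ≤ β ∧ ¬ β ≤ α ∧
    g = X α * X β - X (α ⊓ β) * X (α ⊔ β)}

variable {P : Type*} [PartialOrder P] {l : ℕ}

/-- For a chain `C = {c_1 < ⋯ < c_l}`, the set `𝔭(C) = {C_0, …, C_l}` of its initial segments
`C_i = {c_1, …, c_i}`. -/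
def initialSegments (c : Fin l ↪o P) : Set (Set P) :=
  Set.range fun i : Fin (l + 1) => c '' {j : Fin l | (j : ℕ) < (i : ℕ)}

theorem inter_mem_initialSegments (c : Fin l ↪o P) (α : LowerSet P) :
    (α : Set P) ∩ Set.range c ∈ initialSegments c := by
  classical
  have hP : ∃ i : ℕ, i ≤ l ∧ ∀ j : Fin l, c j ∈ α → (j : ℕ) < i :=
    ⟨l, le_rfl, fun j _ => j.2⟩
  obtain ⟨hi, hlt⟩ := Nat.find_spec hP
  refine ⟨⟨Nat.find hP, Nat.lt_succ_of_le hi⟩, ?_⟩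
  ext x
  constructor
  · rintro ⟨j, hj, rfl⟩
    refine ⟨?_, j, rfl⟩
    by_contra hjα
    refine Nat.find_min hP (m := (j : ℕ)) hj ⟨j.2.le, fun j' hj' => ?_⟩
    by_contra hle
    exact hjα (α.lower (c.le_iff_le.2 (Fin.le_def.2 (not_lt.1 hle))) hj')
  · rintro ⟨hx, j, rfl⟩
    exact ⟨j, hlt j hx, rfl⟩

/-- The multigrading `deg_{f_C}(x_α) = e_{f_C(α ∩ C)}`, for a chain `C` (the range of `c`) and a
map `f_C : 𝔭(C) → [0, m]`. The poset ideals of `P` are the elements of `LowerSet P`. -/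
noncomputable def chainDegree (c : Fin l ↪o P) {m : ℕ} (f : initialSegments c → Fin (m + 1))
    (α : LowerSet P) : Fin (m + 1) →₀ ℕ :=
  Finsupp.single (f ⟨(α : Set P) ∩ Set.range c, inter_mem_initialSegments c α⟩) 1

end Hibi

end HibiMultidegree

/-! Standard monomials, those supported on a chain of L(P), form a basis of the Hibi ring. They span
by straightening (`exists_isStandard`), and they are independent because the toric map x_α ↦ s ∏_{p
∈ α} t_p sends distinct ones to distinct monomials (`IsStandard.eq_of_weight_eq`). Traces of poset
ideals on the chain C are nested, so the Hibi relations are homogeneous for `chainDegree`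
(`isHibiWeight_chainDegree`).

Sorting standard monomials by support gives, with products over α and d_α = deg x_α, HS = ∑_s ∏_{α ∈
s} t^{d_α} / (1 - t^{d_α}), the sum running over the chains s of L(P). Hence K = ∑_s ∏_{α ∈ s}
t^{d_α} ∏_{α ∉ s} (1 - t^{d_α}). Each d_α is a unit vector, so substituting 1 - t turns the term of
s into t^{deg(s^c)} times a polynomial with constant term 1; its lowest total degree is |L(P)| -
|s|. Chains have at most |P| + 1 elements, with equality exactly for the maximal ones
(`ncard_flag`), and dim 𝕜[P] = |P| + 1 (`ringKrullDim_hibiRing`). The component of degree codim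
therefore sees the maximal chains only, once each. The same count in the standard grading gives the
Hilbert polynomial, whose leading term again comes from maximal chains. -/

namespace HibiMultidegree

open MvPolynomial

/-! ### Krull dimension -/

/-- Incomparability of primes gives `≤`; lying over followed by going up gives `≥`. -/
theorem ringKrullDim_eq_of_isIntegral {R S : Type*} [CommRing R] [CommRing S] [IsDomain S] [Algebra R S]
    [Algebra.IsIntegral R S] (h : Function.Injective (algebraMap R S)) :
    ringKrullDim S = ringKrullDim R := by
  apply le_antisymm
  · refine Order.krullDim_le_of_strictMono (PrimeSpectrum.comap (algebraMap R S)) ?_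
    intro I J hIJ
    exact Ideal.IsIntegral.comap_lt_comap hIJ
  · refine iSup_le fun l => ?_
    obtain ⟨Q, hQ, hQl⟩ := Ideal.exists_ideal_over_prime_of_isIntegral_of_isDomain
      (S := S) l.head.asIdeal (by rw [(RingHom.injective_iff_ker_eq_bot _).1 h]; exact bot_le)
    have : Q.LiesOver l.head.asIdeal := ⟨hQl.symm⟩
    obtain ⟨L, hL, -⟩ := Ideal.exists_ltSeries_of_hasGoingUp l Q
    rw [← hL]
    exact le_iSup (fun p : LTSeries (PrimeSpectrum S) => (p.length : WithBot ℕ∞)) L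

/-- A finitely generated algebra between two polynomial rings in `d` variables has dimension
`d`. -/
theorem ringKrullDim_eq_of_injective_of_injective {k R ι κ : Type*} [Field k] [CommRing R]
    [IsDomain R] [Algebra k R] [Algebra.FiniteType k R] [Finite ι] [Finite κ]
    (hικ : Nat.card ι = Nat.card κ)
    (g : MvPolynomial ι k →ₐ[k] R) (hg : Function.Injective g)
    (h : R →ₐ[k] MvPolynomial κ k) (hh : Function.Injective h) :
    ringKrullDim R = Nat.card κ := by
  -- Noether normalization: the dimension is `s`, which transcendence degrees along `h` and `g`
  -- bound from above and below.
  obtain ⟨s, φ, hφ, hint⟩ := exists_integral_inj_algHom_of_fg k R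
  let := φ.toRingHom.toAlgebra
  have : Algebra.IsIntegral (MvPolynomial (Fin s) k) R := ⟨hint⟩
  have : IsScalarTower k (MvPolynomial (Fin s) k) R :=
    IsScalarTower.of_algebraMap_eq fun x => (φ.commutes x).symm
  have hinj : Function.Injective (algebraMap (MvPolynomial (Fin s) k) R) := hφ
  have : FaithfulSMul (MvPolynomial (Fin s) k) R := (faithfulSMul_iff_algebraMap_injective _ _).2 hinj
  have hs : s ≤ Nat.card κ := by
    have := lift_trdeg_le_of_injective (h.comp φ) (hh.comp hφ)
    rw [MvPolynomial.trdeg_of_isDomain, MvPolynomial.trdeg_of_isDomain] at this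
    simpa [← Nat.cast_card] using this
  have hs' : Nat.card ι ≤ s := by
    have h1 := lift_trdeg_le_of_injective g hg
    have h2 := lift_trdeg_add_eq k (MvPolynomial (Fin s) k) R
    rw [trdeg_eq_zero (R := MvPolynomial (Fin s) k) (A := R), MvPolynomial.trdeg_of_isDomain] at h2
    have h3 : Algebra.trdeg k R = (s : Cardinal) := by
      simpa [eq_comm] using h2
    rw [MvPolynomial.trdeg_of_isDomain, h3] at h1
    simpa [← Nat.cast_card] using h1
  rw [ringKrullDim_eq_of_isIntegral hinj, MvPolynomial.ringKrullDim_of_isNoetherianRing,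
    ringKrullDim_eq_zero_of_field, Nat.card_fin, zero_add, le_antisymm (hικ ▸ hs') hs]

/-! ### Straightening modulo the Hibi relations -/

section Straightening

variable {P : Type*} [PartialOrder P] {A : Type*} [AddCommMonoid A]

/-- A weight on a lattice for which the Hibi relations are homogeneous. -/
def IsHibiWeight {L : Type*} [Lattice L] (w : L → A) : Prop :=
  ∀ α β, w α + w β = w (α ⊓ β) + w (α ⊔ β)

/-- Exponents of standard monomials: their support is a chain. -/
def IsStandard {L : Type*} [Preorder L] (u : L →₀ ℕ) : Prop :=
  IsChain (· ≤ ·) (u.support : Set L)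

theorem IsStandard.of_add {L : Type*} [Preorder L] {u v : L →₀ ℕ} (hu : IsStandard (v + u)) : IsStandard u :=
  IsChain.mono (by
    intro α hα
    simp only [Finset.mem_coe, Finsupp.mem_support_iff, Finsupp.add_apply] at hα ⊢
    omega) hu

theorem isHomogeneousIdeal_hibiIdeal (k : Type*) [Field k] {L : Type*} [Lattice L] {w : L → A}
    (hw : IsHibiWeight w) : IsHomogeneousIdeal w (hibiIdeal k L) := by
  classical
  let _ := weightedGradedAlgebra k w
  intro p hp a
  refine weightedHomogeneousComponent_mem_of_mem k w ?_ hp a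
  refine Ideal.homogeneous_span _ _ ?_
  rintro _ ⟨α, β, -, -, rfl⟩
  refine ⟨w α + w β, Submodule.sub_mem _ ?_ ?_⟩
  · exact (isWeightedHomogeneous_X k w α).mul (isWeightedHomogeneous_X k w β)
  · rw [hw α β]
    exact (isWeightedHomogeneous_X k w _).mul (isWeightedHomogeneous_X k w _)

theorem ncard_inf_add_ncard_sup [Finite P] (α β : LowerSet P) :
    ((α ⊓ β : LowerSet P) : Set P).ncard + ((α ⊔ β : LowerSet P) : Set P).ncard =
      (α : Set P).ncard + (β : Set P).ncard := by
  rw [LowerSet.coe_inf, LowerSet.coe_sup]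
  exact Set.ncard_inter_add_ncard_union _ _

theorem ncard_lt_ncard_of_lt [Finite P] {α β : LowerSet P} (h : α < β) :
    (α : Set P).ncard < (β : Set P).ncard :=
  Set.ncard_lt_ncard (LowerSet.coe_ssubset_coe.2 h)

theorem ncard_le_natCard [Finite P] (α : LowerSet P) : (α : Set P).ncard ≤ Nat.card P := by
  rw [← Set.ncard_univ]
  exact Set.ncard_le_ncard (Set.subset_univ _)

theorem mk_X_mul_X (k : Type*) [Field k] {L : Type*} [Lattice L] {α β : L}
    (h : ¬ α ≤ β) (h' : ¬ β ≤ α) :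
    Ideal.Quotient.mk (hibiIdeal k L) (X α * X β) =
      Ideal.Quotient.mk (hibiIdeal k L) (X (α ⊓ β) * X (α ⊔ β)) :=
  Ideal.Quotient.eq.2 (Ideal.subset_span ⟨α, β, h, h', rfl⟩)

/-- Straightening: modulo the Hibi ideal every monomial is a standard monomial of the same
weight. -/
theorem exists_isStandard [Finite P] (k : Type*) [Field k] {w : LowerSet P → A}
    (hw : IsHibiWeight w) (u : LowerSet P →₀ ℕ) :
    ∃ v, IsStandard v ∧ Finsupp.weight w v = Finsupp.weight w u ∧
      Ideal.Quotient.mk (hibiIdeal k (LowerSet P)) (monomial u 1) =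
        Ideal.Quotient.mk (hibiIdeal k (LowerSet P)) (monomial v 1) := by
  classical
  -- Termination measure: passing to meet and join keeps the sum of the cardinalities but spreads
  -- them apart, so the sum of squares grows. Subtracting from |P|² makes it a decrease, and no
  -- truncation occurs.
  let D : LowerSet P → ℕ := fun α => Nat.card P ^ 2 - (α : Set P).ncard ^ 2
  induction hN : Finsupp.weight D u using Nat.strong_induction_on generalizing u with
  | _ N ih =>
    by_cases hu : IsStandard u
    · exact ⟨u, hu, rfl, rfl⟩
    obtain ⟨α, hα, β, hβ, hαβ, hβα⟩ : ∃ α, u α ≠ 0 ∧ ∃ β, u β ≠ 0 ∧ ¬ α ≤ β ∧ ¬ β ≤ α := by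
      by_contra! hcon
      refine hu fun α hα β hβ _ => ?_
      by_cases h : α ≤ β
      · exact Or.inl h
      · exact Or.inr (hcon α (by simpa using hα) β (by simpa using hβ) h)
    have hne : α ≠ β := fun h => hαβ h.le
    obtain ⟨v, rfl⟩ : ∃ v, u = Finsupp.single α 1 + Finsupp.single β 1 + v := by
      refine exists_add_of_le fun γ => ?_
      simp only [Finsupp.add_apply, Finsupp.single_apply]
      split_ifs with h1 h2 h2
      · exact absurd (h1.trans h2.symm) hne
      · subst h1; omega
      · subst h2; omega
      · omega
    have hlt : D (α ⊓ β) + D (α ⊔ β) < D α + D β := by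
      have h1 := ncard_inf_add_ncard_sup α β
      have h2 := ncard_lt_ncard_of_lt (left_lt_sup.2 hβα)
      have h3 := ncard_lt_ncard_of_lt (right_lt_sup.2 hαβ)
      have b1 := ncard_le_natCard (α ⊓ β)
      have b2 := ncard_le_natCard (α ⊔ β)
      have b3 := ncard_le_natCard α
      have b4 := ncard_le_natCard β
      simp only [D]
      generalize ((α ⊓ β : LowerSet P) : Set P).ncard = a at *
      generalize ((α ⊔ β : LowerSet P) : Set P).ncard = b at *
      generalize (α : Set P).ncard = c at *
      generalize (β : Set P).ncard = d at *
      generalize Nat.card P = n at *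
      have c1 := Nat.pow_le_pow_left b1 2
      have c2 := Nat.pow_le_pow_left b2 2
      have c3 := Nat.pow_le_pow_left b3 2
      have c4 := Nat.pow_le_pow_left b4 2
      have : c ^ 2 + d ^ 2 < a ^ 2 + b ^ 2 := by
        obtain ⟨e, rfl⟩ := Nat.exists_eq_add_of_lt h2
        obtain ⟨f, rfl⟩ : ∃ f, d = a + f := ⟨d - a, by omega⟩
        obtain rfl : f = e + 1 := by omega
        nlinarith
      omega
    obtain ⟨v', hv', hwt, hmk⟩ := ih
      (Finsupp.weight D (Finsupp.single (α ⊓ β) 1 + Finsupp.single (α ⊔ β) 1 + v))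
      (by
        rw [← hN]
        simpa [Finsupp.weight_single] using hlt) _ rfl
    refine ⟨v', hv', ?_, ?_⟩
    · rw [hwt]
      simp only [map_add, Finsupp.weight_single, one_smul]
      rw [hw α β]
    · rw [← hmk]
      have key : ∀ γ δ : LowerSet P, (monomial (Finsupp.single γ 1 + Finsupp.single δ 1 + v) (1 : k))
          = X γ * X δ * monomial v 1 := by
        intro γ δ
        simp [X, monomial_mul]
      rw [key, key, map_mul, mk_X_mul_X k hαβ hβα, ← map_mul]

end Straightening

/-! ### Toric realization and the standard monomial basis -/

section Toric

variable {P : Type*} [PartialOrder P]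

open Classical in
/-- The exponent of the monomial `s ∏_{p ∈ α} t_p`. -/
noncomputable def toricWeight [Finite P] (α : LowerSet P) : Option P →₀ ℕ :=
  Finsupp.equivFunOnFinite.symm fun o => o.elim 1 fun p => if p ∈ α then 1 else 0

variable [Finite P]

@[simp]
theorem toricWeight_none (α : LowerSet P) : toricWeight α none = 1 := rfl

open Classical in
@[simp]
theorem toricWeight_some (α : LowerSet P) (p : P) :
    toricWeight α (some p) = if p ∈ α then 1 else 0 := rfl

theorem isHibiWeight_toricWeight : IsHibiWeight (toricWeight (P := P)) := by
  classical
  intro α β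
  ext (_ | p)
  · simp
  · by_cases hα : p ∈ α <;> by_cases hβ : p ∈ β <;> simp [hα, hβ]

theorem weight_toricWeight_none (u : LowerSet P →₀ ℕ) :
    Finsupp.weight toricWeight u none = u.degree := by
  simp [Finsupp.weight_apply, Finsupp.sum, Finsupp.finsetSum_apply, Finsupp.degree_apply]

theorem weight_toricWeight_some_ne_zero (u : LowerSet P →₀ ℕ) (p : P) :
    Finsupp.weight toricWeight u (some p) ≠ 0 ↔ ∃ α, u α ≠ 0 ∧ p ∈ α := by
  classical
  simp only [Finsupp.weight_apply, Finsupp.sum, Finsupp.finsetSum_apply]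
  simp
  grind

/-- The largest member of the supporting chain contains all the others, so it is exactly the set of
p whose variable t_p occurs in the toric image. -/
theorem IsStandard.exists_max {u : LowerSet P →₀ ℕ} (hu : IsStandard u) (h0 : u ≠ 0) :
    ∃ μ, u μ ≠ 0 ∧ ∀ p, p ∈ μ ↔ Finsupp.weight toricWeight u (some p) ≠ 0 := by
  obtain ⟨μ, hμ⟩ := u.support.exists_maximal (Finsupp.support_nonempty_iff.2 h0)
  refine ⟨μ, by simpa using hμ.1, fun p => ?_⟩
  rw [weight_toricWeight_some_ne_zero]
  refine ⟨fun hp => ⟨μ, by simpa using hμ.1, hp⟩, ?_⟩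
  rintro ⟨α, hα, hp⟩
  have hα' : α ∈ u.support := by simpa using hα
  rcases hu.total hα' hμ.1 with h | h
  · exact h hp
  · exact hμ.2 hα' h hp

/-- The toric monomial determines the top of the chain; cancel that variable and induct on the
degree, which is the exponent of s. -/
theorem IsStandard.eq_of_weight_eq {u v : LowerSet P →₀ ℕ} (hu : IsStandard u) (hv : IsStandard v)
    (h : Finsupp.weight toricWeight u = Finsupp.weight toricWeight v) : u = v := by
  induction hN : u.degree generalizing u v with
  | zero =>
    have h' : v.degree = 0 := by
      rw [← weight_toricWeight_none, ← h, weight_toricWeight_none, hN]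
    rw [Finsupp.degree_eq_zero_iff] at hN h'
    rw [hN, h']
  | succ N ih =>
    have h' : v.degree = N + 1 := by
      rw [← weight_toricWeight_none, ← h, weight_toricWeight_none, hN]
    obtain ⟨μ, hμ, hμ'⟩ := hu.exists_max (by rintro rfl; simp at hN)
    obtain ⟨ν, hν, hν'⟩ := hv.exists_max (by rintro rfl; simp at h')
    obtain rfl : μ = ν := by
      ext p
      exact (hμ' p).trans (h ▸ (hν' p).symm)
    obtain ⟨u, rfl⟩ := exists_add_of_le
      (Finsupp.single_le_iff.2 (Nat.one_le_iff_ne_zero.2 hμ))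
    obtain ⟨v, rfl⟩ := exists_add_of_le
      (Finsupp.single_le_iff.2 (Nat.one_le_iff_ne_zero.2 hν))
    rw [map_add, map_add, add_right_inj] at h
    rw [ih hu.of_add hv.of_add h (by simpa [add_comm 1] using hN)]

end Toric

section ToricHom

variable (k : Type*) [Field k] (P : Type*) [PartialOrder P] [Finite P]

/-- The Hibi ring as a toric ring: `x_α ↦ s ∏_{p ∈ α} t_p`. -/
noncomputable def toricHom : MvPolynomial (LowerSet P) k →ₐ[k] MvPolynomial (Option P) k :=
  aeval fun α => monomial (toricWeight α) 1

variable {P}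

theorem toricHom_monomial (u : LowerSet P →₀ ℕ) :
    toricHom k P (monomial u 1) = monomial (Finsupp.weight toricWeight u) 1 := by
  simp only [toricHom, aeval_monomial, map_one, one_mul, monomial_pow, one_pow,
    Finsupp.weight_apply]
  rw [Finsupp.prod, Finsupp.sum, monomial_sum_one]

variable (P)

theorem toricHom_eq_zero (p : MvPolynomial (LowerSet P) k) (hp : p ∈ hibiIdeal k (LowerSet P)) :
    toricHom k P p = 0 := by
  have : hibiIdeal k (LowerSet P) ≤ RingHom.ker (toricHom k P) := by
    refine Ideal.span_le.2 ?_
    rintro _ ⟨α, β, -, -, rfl⟩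
    simp [toricHom, isHibiWeight_toricWeight α β, monomial_mul]
  exact this hp

/-- The map induced by `toricHom` on the Hibi ring. -/
noncomputable def hibiToToric :
    (MvPolynomial (LowerSet P) k ⧸ hibiIdeal k (LowerSet P)) →ₐ[k] MvPolynomial (Option P) k :=
  Ideal.Quotient.liftₐ _ (toricHom k P) (toricHom_eq_zero k P)

/-- The class of a standard monomial in the Hibi ring. -/
noncomputable def standardMonomial (u : {u : LowerSet P →₀ ℕ // IsStandard u}) :
    MvPolynomial (LowerSet P) k ⧸ hibiIdeal k (LowerSet P) :=
  Ideal.Quotient.mk _ (monomial u.1 1)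

theorem linearIndependent_hibiToToric_standardMonomial :
    LinearIndependent k ((hibiToToric k P).toLinearMap ∘ standardMonomial k P) := by
  have : ((hibiToToric k P).toLinearMap ∘ standardMonomial k P) =
      (basisMonomials (Option P) k) ∘ fun u => Finsupp.weight toricWeight u.1 := by
    ext1 u
    simp only [Function.comp, coe_basisMonomials, ← toricHom_monomial]
    rfl
  rw [this]
  exact (basisMonomials (Option P) k).linearIndependent.comp _
    fun u v h => Subtype.ext (u.2.eq_of_weight_eq v.2 h)

theorem linearIndependent_standardMonomial : LinearIndependent k (standardMonomial k P) :=
  (linearIndependent_hibiToToric_standardMonomial k P).of_comp _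

variable {P}

/-- Straightening preserves the weight, so it can be carried out inside one graded piece. -/
theorem map_weightedHomogeneousSubmodule {A : Type*} [AddCommMonoid A] {w : LowerSet P → A}
    (hw : IsHibiWeight w) (a : A) :
    (weightedHomogeneousSubmodule k w a).map
        (Ideal.Quotient.mkₐ k (hibiIdeal k (LowerSet P))).toLinearMap =
      Submodule.span k (Set.range fun u : {u : {u : LowerSet P →₀ ℕ // IsStandard u} //
        Finsupp.weight w u.1 = a} => standardMonomial k P u.1) := by
  apply le_antisymm
  · rw [Submodule.map_le_iff_le_comap]
    intro p hp
    rw [p.as_sum]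
    refine Submodule.sum_mem _ fun u hu => ?_
    obtain ⟨v, hv, hwt, hmk⟩ := exists_isStandard k hw u
    have : monomial u (coeff u p) = coeff u p • monomial u (1 : k) := by
      simp [smul_monomial]
    rw [this]
    refine Submodule.smul_mem _ _ ?_
    refine Submodule.subset_span ⟨⟨⟨v, hv⟩, hwt.trans (hp (by simpa using hu))⟩, ?_⟩
    exact hmk.symm
  · rw [Submodule.span_le]
    rintro _ ⟨⟨u, hu⟩, rfl⟩
    exact ⟨monomial u.1 1, isWeightedHomogeneous_monomial w _ _ hu, rfl⟩

theorem hilbertFunction_hibiIdeal {A : Type*} [AddCommMonoid A] {w : LowerSet P → A}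
    (hw : IsHibiWeight w) (a : A)
    (hfin : {u : LowerSet P →₀ ℕ | IsStandard u ∧ Finsupp.weight w u = a}.Finite) :
    hilbertFunction w (hibiIdeal k (LowerSet P)) a =
      {u : LowerSet P →₀ ℕ | IsStandard u ∧ Finsupp.weight w u = a}.ncard := by
  let e : {u : {u : LowerSet P →₀ ℕ // IsStandard u} // Finsupp.weight w u.1 = a} ≃
      {u : LowerSet P →₀ ℕ | IsStandard u ∧ Finsupp.weight w u = a} :=
    Equiv.subtypeSubtypeEquivSubtypeInter IsStandard fun u => Finsupp.weight w u = a
  have := hfin.to_subtype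
  have := Finite.of_equiv _ e.symm
  have := Fintype.ofFinite {u : {u : LowerSet P →₀ ℕ // IsStandard u} // Finsupp.weight w u.1 = a}
  rw [hilbertFunction, map_weightedHomogeneousSubmodule k hw, finrank_span_eq_card,
    ← Nat.card_eq_fintype_card, Nat.card_congr e, Nat.card_coe_set_eq]
  exact (linearIndependent_standardMonomial k P).comp _ Subtype.val_injective

variable (P)

theorem injective_hibiToToric : Function.Injective (hibiToToric k P) := by
  have hspan : ⊤ ≤ Submodule.span k (Set.range (standardMonomial k P)) := by
    intro x _
    obtain ⟨p, rfl⟩ := Ideal.Quotient.mk_surjective x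
    -- With the zero weight a single graded piece is the whole ring, so the graded spanning result
    -- applies to every element.
    have hw : IsHibiWeight (fun _ : LowerSet P => (0 : ℕ)) := fun _ _ => rfl
    have hp : p ∈ weightedHomogeneousSubmodule k (fun _ : LowerSet P => (0 : ℕ)) 0 := by
      intro d _
      simp [Finsupp.weight_apply]
    have := map_weightedHomogeneousSubmodule k hw 0 ▸ Submodule.mem_map_of_mem (f :=
      (Ideal.Quotient.mkₐ k (hibiIdeal k (LowerSet P))).toLinearMap) hp
    refine Submodule.span_mono ?_ this
    rintro _ ⟨u, rfl⟩
    exact ⟨u.1, rfl⟩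
  rw [injective_iff_map_eq_zero]
  intro x hx
  obtain ⟨c, rfl⟩ := (Finsupp.mem_span_range_iff_exists_finsupp).1 (hspan (Submodule.mem_top (x := x)))
  have := linearIndependent_iff.1 (linearIndependent_hibiToToric_standardMonomial k P) c (by
    rw [← hx]
    simp [Finsupp.linearCombination_apply, Finsupp.sum])
  simp [this]

instance isDomain_hibiRing :
    IsDomain (MvPolynomial (LowerSet P) k ⧸ hibiIdeal k (LowerSet P)) :=
  (injective_hibiToToric k P).isDomain (hibiToToric k P).toRingHom

/-- Monomials in the variables of a chain are all standard, so the polynomial ring on `s` embeds in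
the Hibi ring, which in turn embeds in the toric polynomial ring; both have |P| + 1 variables. -/
theorem ringKrullDim_hibiRing {s : Set (LowerSet P)} (hs : IsChain (· ≤ ·) s)
    (hcard : s.ncard = Nat.card P + 1) :
    ringKrullDim (MvPolynomial (LowerSet P) k ⧸ hibiIdeal k (LowerSet P)) =
      (Nat.card P + 1 : ℕ) := by
  classical
  have hinj : Function.Injective
      ((Ideal.Quotient.mkₐ k (hibiIdeal k (LowerSet P))).comp
        (rename (R := k) (Subtype.val : s → LowerSet P))) := by
    rw [injective_iff_map_eq_zero]
    intro p hp
    let e : (s →₀ ℕ) → {u : LowerSet P →₀ ℕ // IsStandard u} := fun u =>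
      ⟨u.mapDomain Subtype.val, hs.mono fun α hα => by
        obtain ⟨β, -, rfl⟩ := Finset.mem_image.1 (Finsupp.mapDomain_support hα)
        exact β.2⟩
    have he : Function.Injective e := fun u v h =>
      Finsupp.mapDomain_injective Subtype.val_injective (Subtype.ext_iff.1 h)
    have hli := (linearIndependent_standardMonomial k P).comp e he
    rw [linearIndependent_iff'] at hli
    ext u
    by_cases hu : u ∈ p.support
    · rw [coeff_zero]
      refine hli p.support (fun u => coeff u p) ?_ u hu
      rw [← hp]
      conv_rhs => rw [p.as_sum]
      rw [map_sum]
      refine Finset.sum_congr rfl fun v _ => ?_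
      have : monomial v (coeff v p) = coeff v p • monomial v (1 : k) := by
        simp [smul_monomial]
      rw [this, map_smul, AlgHom.comp_apply, rename_monomial]
      rfl
    · simpa using hu
  have hd := ringKrullDim_eq_of_injective_of_injective (ι := s) (κ := Option P)
    (by rw [Nat.card_coe_set_eq, hcard, Finite.card_option]) _ hinj _ (injective_hibiToToric k P)
  rw [hd, Finite.card_option]

end ToricHom

/-! ### Maximal chains of poset ideals -/

section MaximalChains

variable {P : Type*} [PartialOrder P] [Finite P]

instance finite_lowerSet : Finite (LowerSet P) :=
  Finite.of_injective _ (SetLike.coe_injective (A := LowerSet P) (B := P))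

theorem ncard_le_of_isChain {s : Set (LowerSet P)} (hs : IsChain (· ≤ ·) s) :
    s.ncard ≤ Nat.card P + 1 := by
  have := Set.ncard_le_ncard_of_injOn (s := s) (t := Set.Iic (Nat.card P))
    (fun α => (α : Set P).ncard) (fun α _ => ncard_le_natCard α) ?_ (Set.finite_Iic _)
  · rwa [← Finset.coe_Iic, Set.ncard_coe_finset, Nat.card_Iic] at this
  · intro α hα β hβ h
    by_contra hne
    rcases hs.total hα hβ with h' | h'
    · exact (ncard_lt_ncard_of_lt (lt_of_le_of_ne h' hne)).ne h
    · exact (ncard_lt_ncard_of_lt (lt_of_le_of_ne h' (Ne.symm hne))).ne h.symm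

/-- Adjoining to α a minimal element of β \ α keeps it down-closed and adds only one element. -/
theorem exists_between_of_ncard_lt {α β : LowerSet P} (h : α ≤ β)
    (hc : (α : Set P).ncard + 1 < (β : Set P).ncard) : ∃ γ, α < γ ∧ γ < β := by
  have hne : ((β : Set P) \ α).Nonempty := by
    rw [Set.sdiff_nonempty]
    intro hle
    have := Set.ncard_le_ncard hle
    omega
  obtain ⟨p, hp⟩ := (Set.toFinite ((β : Set P) \ α)).exists_minimal hne
  let γ : LowerSet P := ⟨insert p (α : Set P), by
    rintro x y hyx (rfl | hx)
    · by_cases hy : y ∈ α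
      · exact Or.inr hy
      · exact Or.inl (le_antisymm hyx (hp.2 ⟨β.lower hyx hp.1.1, hy⟩ hyx))
    · exact Or.inr (α.lower hyx hx)⟩
  have hγ : (γ : Set P).ncard = (α : Set P).ncard + 1 := Set.ncard_insert_of_notMem hp.1.2
  refine ⟨γ, lt_of_le_of_ne (fun x hx => Or.inr hx) ?_, lt_of_le_of_ne ?_ ?_⟩
  · rintro heq
    rw [← heq] at hγ
    omega
  · rintro x (rfl | hx)
    · exact hp.1.1
    · exact h hx
  · intro heq
    rw [← heq] at hc
    omega

/-- Every cardinality i from 0 to |P| occurs in the flag: otherwise a poset ideal fits strictly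
between the largest member of size at most i and the smallest of size at least i, and maximality
puts it in the flag, a contradiction. -/
theorem ncard_flag (M : Flag (LowerSet P)) : (M : Set (LowerSet P)).ncard = Nat.card P + 1 := by
  refine le_antisymm (ncard_le_of_isChain M.chain_le) ?_
  have hsub : Set.Iic (Nat.card P) ⊆
      (fun α : LowerSet P => (α : Set P).ncard) '' (M : Set (LowerSet P)) := by
    intro i hi
    obtain ⟨α, hα⟩ := (Set.toFinite {α | α ∈ M ∧ (α : Set P).ncard ≤ i}).exists_maximal
      ⟨⊥, M.bot_mem, by simp⟩
    obtain ⟨β, hβ⟩ := (Set.toFinite {β | β ∈ M ∧ i ≤ (β : Set P).ncard}).exists_minimal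
      ⟨⊤, M.top_mem, by simpa [Set.ncard_univ] using hi⟩
    obtain ⟨⟨hαM, hαi⟩, hαmax⟩ := hα
    obtain ⟨⟨hβM, hβi⟩, hβmin⟩ := hβ
    by_cases h1 : (α : Set P).ncard = i
    · exact ⟨α, hαM, h1⟩
    by_cases h2 : (β : Set P).ncard = i
    · exact ⟨β, hβM, h2⟩
    exfalso
    have hle : α ≤ β := by
      rcases M.le_or_le hαM hβM with h | h
      · exact h
      · have := Set.ncard_le_ncard (LowerSet.coe_subset_coe.2 h)
        omega
    obtain ⟨γ, hαγ, hγβ⟩ := exists_between_of_ncard_lt hle (by omega)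
    have hγM : γ ∈ M := by
      rw [Flag.mem_iff_forall_le_or_ge]
      intro δ hδ
      rcases le_total (δ : Set P).ncard i with h | h
      · refine Or.inr (le_trans ?_ hαγ.le)
        rcases M.le_or_le hαM hδ with h' | h'
        · exact hαmax ⟨hδ, h⟩ h'
        · exact h'
      · refine Or.inl (hγβ.le.trans ?_)
        rcases M.le_or_le hβM hδ with h' | h'
        · exact h'
        · exact hβmin ⟨hδ, h⟩ h'
    rcases le_total (γ : Set P).ncard i with h | h
    · exact absurd (hαmax ⟨hγM, h⟩ hαγ.le) (not_le_of_gt hαγ)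
    · exact absurd (hβmin ⟨hγM, h⟩ hγβ.le) (not_le_of_gt hγβ)
  have := (Set.ncard_le_ncard hsub (Set.toFinite _)).trans (Set.ncard_image_le (Set.toFinite _))
  rwa [← Finset.coe_Iic, Set.ncard_coe_finset, Nat.card_Iic] at this

/-- The flags of `LowerSet P` are its chains with `|P| + 1` elements. -/
noncomputable def flagEquiv :
    Flag (LowerSet P) ≃ {s : Finset (LowerSet P) //
      IsChain (· ≤ ·) (s : Set (LowerSet P)) ∧ s.card = Nat.card P + 1} where
  toFun M := ⟨(Set.toFinite (M : Set (LowerSet P))).toFinset, by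
    simpa using M.chain_le, by
    rw [← Set.ncard_eq_toFinset_card, ncard_flag]⟩
  invFun s := Flag.ofIsMaxChain (s.1 : Set (LowerSet P)) ⟨s.2.1, fun t ht hst =>
    Set.eq_of_subset_of_ncard_le hst (by
      rw [Set.ncard_coe_finset, s.2.2]; exact ncard_le_of_isChain ht) (Set.toFinite _)⟩
  left_inv M := by
    apply Flag.ext
    simp
  right_inv s := by
    apply Subtype.ext
    ext α
    exact (Set.Finite.mem_toFinset _).trans Finset.mem_coe

theorem coe_flagEquiv (M : Flag (LowerSet P)) :
    ((flagEquiv M).1 : Set (LowerSet P)) = M := by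
  simp [flagEquiv]

theorem natCard_flag_pos : 0 < Nat.card (Flag (LowerSet P)) := by
  have : Finite (Flag (LowerSet P)) := Finite.of_equiv _ flagEquiv.symm
  have : Nonempty (Flag (LowerSet P)) := inferInstance
  exact Nat.card_pos

theorem ringKrullDim_hibiRing_eq (k : Type*) [Field k] (P : Type*) [PartialOrder P] [Finite P] :
    ringKrullDim (MvPolynomial (LowerSet P) k ⧸ hibiIdeal k (LowerSet P)) =
      (Nat.card P + 1 : ℕ) := by
  obtain ⟨M⟩ : Nonempty (Flag (LowerSet P)) := inferInstance
  exact ringKrullDim_hibiRing k P M.chain_le (ncard_flag M)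

end MaximalChains

/-! ### Generating series of monomials with fixed support -/

section FaceSeries

variable {ι τ : Type*} {w : ι → (τ →₀ ℕ)}

/-- The generating series, by weight, of the monomials with support `s`. -/
noncomputable def faceSeries (w : ι → (τ →₀ ℕ)) (s : Finset ι) : MvPowerSeries τ ℤ :=
  fun a => ({u : ι →₀ ℕ | u.support = s ∧ Finsupp.weight w u = a}.ncard : ℤ)

theorem coeff_faceSeries (s : Finset ι) (a : τ →₀ ℕ) :
    MvPowerSeries.coeff a (faceSeries w s) =
      ({u : ι →₀ ℕ | u.support = s ∧ Finsupp.weight w u = a}.ncard : ℤ) := rfl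

theorem faceSeries_empty : faceSeries w ∅ = 1 := by
  classical
  ext a
  rw [coeff_faceSeries, MvPowerSeries.coeff_one]
  have : {u : ι →₀ ℕ | u.support = ∅ ∧ Finsupp.weight w u = a} = if a = 0 then {0} else ∅ := by
    ext u
    split_ifs with h <;> simp only [Finsupp.support_eq_empty, Set.mem_ofPred_eq,
      Set.mem_singleton_iff, Set.mem_empty_iff_false, iff_false, not_and]
    · constructor
      · exact fun h => h.1
      · rintro rfl
        simp [h]
    · rintro rfl
      simpa [eq_comm] using h
  rw [this]
  split_ifs <;> simp

variable [DecidableEq ι]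

/-- Dividing a monomial with support `insert i s` by x_i leaves support `s` or `insert i s`,
according to whether the exponent of x_i was 1 or larger. -/
theorem one_sub_mul_faceSeries_insert
    (hfin : ∀ a, {u : ι →₀ ℕ | Finsupp.weight w u = a}.Finite) {i : ι} {s : Finset ι}
    (hi : i ∉ s) :
    (1 - MvPowerSeries.monomial (w i) (1 : ℤ)) * faceSeries w (insert i s) =
      MvPowerSeries.monomial (w i) 1 * faceSeries w s := by
  classical
  rw [sub_mul, one_mul, sub_eq_iff_eq_add]
  ext a
  rw [map_add, MvPowerSeries.coeff_monomial_mul, MvPowerSeries.coeff_monomial_mul]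
  simp only [coeff_faceSeries, one_mul]
  split_ifs with ha
  · have himg : {u : ι →₀ ℕ | u.support = insert i s ∧ Finsupp.weight w u = a} =
        (fun u => u + Finsupp.single i 1) ''
          ({u : ι →₀ ℕ | u.support = s ∧ Finsupp.weight w u = a - w i} ∪
            {u : ι →₀ ℕ | u.support = insert i s ∧ Finsupp.weight w u = a - w i}) := by
      ext u
      simp only [Set.mem_image, Set.mem_union, Set.mem_ofPred_eq]
      constructor
      · rintro ⟨hs, hu⟩
        have hui : u i ≠ 0 := by
          rw [← Finsupp.mem_support_iff, hs]
          exact Finset.mem_insert_self _ _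
        obtain ⟨v, rfl⟩ := exists_add_of_le
          (Finsupp.single_le_iff.2 (Nat.one_le_iff_ne_zero.2 hui))
        refine ⟨v, ?_, add_comm _ _⟩
        have hw : Finsupp.weight w v = a - w i := by
          rw [← hu]
          simp [Finsupp.weight_single]
        simp only [hw, and_true]
        have hsv : ∀ j, j ≠ i → (v j ≠ 0 ↔ j ∈ s) := by
          intro j hj
          have := Finset.ext_iff.1 hs j
          simpa [hj, Ne.symm hj] using this
        by_cases hv : v i = 0
        · left
          ext j
          by_cases hj : j = i
          · subst hj; simp [hv, hi]
          · rw [Finsupp.mem_support_iff, hsv j hj]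
        · right
          ext j
          by_cases hj : j = i
          · subst hj; simp [hv]
          · rw [Finsupp.mem_support_iff, hsv j hj]; simp [hj]
      · rintro ⟨v, hv, rfl⟩
        constructor
        · ext j
          by_cases hj : j = i
          · subst hj; simp
          · rcases hv with ⟨rfl, -⟩ | ⟨hv, -⟩
            · simp [hj]
            · rw [← hv]; simp [Ne.symm hj]
        · have hwv : Finsupp.weight w v = a - w i := by rcases hv with h | h <;> exact h.2
          rw [map_add, hwv, Finsupp.weight_single, one_smul, tsub_add_cancel_of_le ha]
    rw [himg, Set.ncard_image_of_injective _ (add_left_injective _), Set.ncard_union_eq ?_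
      ((hfin _).subset fun u hu => hu.2) ((hfin _).subset fun u hu => hu.2)]
    · push_cast
      rw [add_comm]
    · rw [Set.disjoint_left]
      rintro u ⟨h1, -⟩ ⟨h2, -⟩
      exact hi (h1 ▸ h2 ▸ Finset.mem_insert_self _ _)
  · have : {u : ι →₀ ℕ | u.support = insert i s ∧ Finsupp.weight w u = a} = ∅ := by
      rw [Set.eq_empty_iff_forall_notMem]
      rintro u ⟨hs, rfl⟩
      apply ha
      have hui : u i ≠ 0 := by
        rw [← Finsupp.mem_support_iff, hs]
        exact Finset.mem_insert_self _ _
      exact Finsupp.le_weight_of_ne_zero' w hui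
    rw [this]
    simp

theorem faceSeries_mul_prod
    (hfin : ∀ a, {u : ι →₀ ℕ | Finsupp.weight w u = a}.Finite) (s : Finset ι) :
    faceSeries w s * ∏ i ∈ s, (1 - MvPowerSeries.monomial (w i) (1 : ℤ)) =
      ∏ i ∈ s, MvPowerSeries.monomial (w i) (1 : ℤ) := by
  induction s using Finset.induction_on with
  | empty => simp [faceSeries_empty]
  | insert i s hi ih =>
    rw [Finset.prod_insert hi, Finset.prod_insert hi, ← ih, ← mul_assoc, ← mul_assoc,
      mul_comm (faceSeries _ _), one_sub_mul_faceSeries_insert hfin hi]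

end FaceSeries

/-! ### Lowest-degree components of products -/

section Components

theorem homogeneousComponent_mul_of_lt {σ R : Type*} [CommSemiring R] (p : MvPolynomial σ R)
    {q : MvPolynomial σ R} {d e : ℕ} (hq : q.IsHomogeneous e) (h : d < e) :
    homogeneousComponent d (p * q) = 0 := by
  conv_lhs => rw [← sum_homogeneousComponent p, Finset.sum_mul, map_sum]
  refine Finset.sum_eq_zero fun i _ => ?_
  rw [homogeneousComponent_of_mem ((homogeneousComponent_isHomogeneous i p).mul hq),
    if_neg (by omega)]

theorem homogeneousComponent_mul_self {σ R : Type*} [CommSemiring R] (p : MvPolynomial σ R)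
    {q : MvPolynomial σ R} {e : ℕ} (hq : q.IsHomogeneous e) :
    homogeneousComponent e (p * q) = C (constantCoeff p) * q := by
  conv_lhs => rw [← sum_homogeneousComponent p, Finset.sum_mul, map_sum]
  rw [Finset.sum_eq_single 0]
  · rw [homogeneousComponent_of_mem ((homogeneousComponent_isHomogeneous 0 p).mul hq),
      if_pos (by omega), homogeneousComponent_zero, constantCoeff_eq]
  · intro i _ hi
    rw [homogeneousComponent_of_mem ((homogeneousComponent_isHomogeneous i p).mul hq),
      if_neg (by omega)]
  · simp

end Components

/-! ### Hilbert series, K-polynomial and multidegree -/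

section KPolynomial

variable {P : Type*} [PartialOrder P] [Finite P] [Fintype (LowerSet P)]

open Classical in
/-- The finite set of chains of `LowerSet P`. -/
noncomputable def chainFinset (P : Type*) [PartialOrder P] [Fintype (LowerSet P)] :
    Finset (Finset (LowerSet P)) :=
  Finset.univ.filter fun s => IsChain (· ≤ ·) (s : Set (LowerSet P))

theorem mem_chainFinset {P : Type*} [PartialOrder P] [Fintype (LowerSet P)] {s : Finset (LowerSet P)} :
    s ∈ chainFinset P ↔ IsChain (· ≤ ·) (s : Set (LowerSet P)) := by
  simp [chainFinset]

theorem card_le_of_mem_chainFinset {s : Finset (LowerSet P)} (hs : s ∈ chainFinset P) :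
    s.card ≤ Nat.card P + 1 := by
  rw [← Set.ncard_coe_finset]
  exact ncard_le_of_isChain (mem_chainFinset.1 hs)

/-- Standard monomials of a given weight, sorted by their supports. -/
theorem ncard_isStandard {P : Type*} [PartialOrder P] [Fintype (LowerSet P)] {A : Type*} [AddCommMonoid A] {w : LowerSet P → A} {a : A}
    (hfin : {u : LowerSet P →₀ ℕ | Finsupp.weight w u = a}.Finite) :
    {u : LowerSet P →₀ ℕ | IsStandard u ∧ Finsupp.weight w u = a}.ncard =
      ∑ s ∈ chainFinset P,
        {u : LowerSet P →₀ ℕ | u.support = s ∧ Finsupp.weight w u = a}.ncard := by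
  classical
  have hf : {u : LowerSet P →₀ ℕ | IsStandard u ∧ Finsupp.weight w u = a}.Finite :=
    hfin.subset fun u hu => hu.2
  rw [Set.ncard_eq_toFinset_card _ hf,
    Finset.card_eq_sum_card_fiberwise (f := Finsupp.support) (t := chainFinset P)]
  · refine Finset.sum_congr rfl fun s hs => ?_
    rw [← Set.ncard_coe_finset]
    congr 1
    ext u
    simp only [Finset.coe_filter, Set.Finite.mem_toFinset, Set.mem_ofPred_eq]
    constructor
    · rintro ⟨⟨-, h⟩, h'⟩
      exact ⟨h', h⟩
    · rintro ⟨rfl, h⟩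
      exact ⟨⟨mem_chainFinset.1 hs, h⟩, rfl⟩
  · intro u hu
    exact mem_chainFinset.2 ((Set.Finite.mem_toFinset hf).1 hu).1

variable (k : Type*) [Field k] {τ : Type*}

theorem hilbertSeries_hibiIdeal {w : LowerSet P → (τ →₀ ℕ)} (hw : IsHibiWeight w)
    (hfin : ∀ a, {u : LowerSet P →₀ ℕ | Finsupp.weight w u = a}.Finite) :
    hilbertSeries w (hibiIdeal k (LowerSet P)) = ∑ s ∈ chainFinset P, faceSeries w s := by
  ext a
  rw [map_sum]
  simp only [coeff_faceSeries]
  rw [← Nat.cast_sum, ← ncard_isStandard (hfin a),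
    ← hilbertFunction_hibiIdeal k hw a ((hfin a).subset fun u hu => hu.2)]
  rfl

open Classical in
/-- The K-polynomial of the Hibi ring. -/
noncomputable def hibiKPolynomial (w : LowerSet P → (τ →₀ ℕ)) : MvPolynomial τ ℤ :=
  ∑ s ∈ chainFinset P, (∏ α ∈ s, monomial (w α) 1) * ∏ α ∈ sᶜ, (1 - monomial (w α) 1)

theorem isKPolynomial_hibiKPolynomial {w : LowerSet P → (τ →₀ ℕ)} (hw : IsHibiWeight w)
    (hfin : ∀ a, {u : LowerSet P →₀ ℕ | Finsupp.weight w u = a}.Finite) :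
    IsKPolynomial w (hibiIdeal k (LowerSet P)) (hibiKPolynomial w) := by
  classical
  have hcoe : ∀ p : MvPolynomial τ ℤ,
    (p : MvPowerSeries τ ℤ) = MvPolynomial.coeToMvPowerSeries.ringHom p := fun _ => rfl
  rw [IsKPolynomial, hilbertSeries_hibiIdeal k hw hfin, finprod_eq_prod_of_fintype,
    hibiKPolynomial, hcoe, map_sum, Finset.sum_mul]
  refine Finset.sum_congr rfl fun s _ => ?_
  rw [map_mul, map_prod, map_prod, ← Finset.prod_mul_prod_compl s fun α => _, ← mul_assoc,
    faceSeries_mul_prod hfin]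
  congr 1
  · simp [MvPolynomial.coe_monomial]
  · exact Finset.prod_congr rfl fun α _ => by
      rw [map_sub, map_one, ← hcoe, MvPolynomial.coe_monomial]

variable {j : LowerSet P → τ}

theorem finite_weight_single_eq {ι : Type*} [Finite ι] (j : ι → τ) (a : τ →₀ ℕ) :
    {u : ι →₀ ℕ | Finsupp.weight (fun i => Finsupp.single (j i) 1) u = a}.Finite := by
  refine (Finsupp.finite_of_degree_le a.degree).subset ?_
  rintro u rfl
  rw [Finsupp.weight_apply, Finsupp.sum, map_sum]
  simp [Finsupp.degree_single, Finsupp.degree_apply u]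

-- The factor ∏_{α ∉ s} t_{j(α)} is homogeneous of degree |L(P)| - |s|. This exceeds the codimension
-- unless |s| = |P| + 1, and then only the constant term 1 of ∏_{α ∈ s} (1 - t_{j(α)}) contributes.
open Classical in
theorem homogeneousComponent_hibiKPolynomial (h : Nat.card P + 1 ≤ Fintype.card (LowerSet P)) :
    homogeneousComponent (Fintype.card (LowerSet P) - (Nat.card P + 1))
      (aeval (fun j : τ => (1 - X j : MvPolynomial τ ℤ))
        (hibiKPolynomial fun α => Finsupp.single (j α) 1)) =
      ∑ s ∈ chainFinset P with s.card = Nat.card P + 1,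
        monomial (∑ α ∈ sᶜ, Finsupp.single (j α) 1) (1 : ℤ) := by
  rw [hibiKPolynomial, map_sum, map_sum, Finset.sum_filter]
  refine Finset.sum_congr rfl fun s hs => ?_
  have hX : ∀ i : τ, monomial (Finsupp.single i 1) (1 : ℤ) = X i := fun _ => rfl
  simp only [hX, map_mul, map_prod, map_sub, map_one, aeval_X, sub_sub_cancel]
  have hhom : (∏ α ∈ sᶜ, (X (j α) : MvPolynomial τ ℤ)).IsHomogeneous
      (Fintype.card (LowerSet P) - s.card) := by
    have := IsHomogeneous.prod sᶜ (fun α => (X (j α) : MvPolynomial τ ℤ)) (fun _ => 1)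
      fun α _ => isHomogeneous_X _ _
    simpa [Finset.card_compl] using this
  split_ifs with hc
  · rw [hc] at hhom
    rw [homogeneousComponent_mul_self _ hhom, monomial_sum_one]
    simp [hX]
  · have := card_le_of_mem_chainFinset hs
    exact homogeneousComponent_mul_of_lt _ hhom (by omega)

open Classical in
theorem finsum_flag {M : Type*} [AddCommMonoid M] (g : Set (LowerSet P) → M) :
    ∑ᶠ F : Flag (LowerSet P), g F = ∑ s ∈ chainFinset P with s.card = Nat.card P + 1, g s := by
  have : Finite (Flag (LowerSet P)) := Finite.of_equiv _ flagEquiv.symm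
  have := Fintype.ofFinite (Flag (LowerSet P))
  rw [finsum_eq_sum_of_fintype]
  refine Finset.sum_bij (fun F _ => (flagEquiv F).1) ?_ ?_ ?_ ?_
  · intro F _
    simpa [mem_chainFinset] using (flagEquiv F).2
  · intro F _ G _ h
    exact flagEquiv.injective (Subtype.ext h)
  · intro s hs
    rw [Finset.mem_filter, mem_chainFinset] at hs
    exact ⟨flagEquiv.symm ⟨s, hs⟩, Finset.mem_univ _, by simp⟩
  · intro F _
    rw [coe_flagEquiv]

theorem natCard_flag [DecidableEq (LowerSet P)] : Nat.card (Flag (LowerSet P)) =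
    ((chainFinset P).filter fun s => s.card = Nat.card P + 1).card := by
  classical
  rw [Nat.card_congr flagEquiv, Nat.card_eq_fintype_card, Fintype.card_subtype]
  congr 1
  ext s
  simp [mem_chainFinset]

theorem card_le_card_lowerSet : Nat.card P + 1 ≤ Fintype.card (LowerSet P) := by
  obtain ⟨M⟩ : Nonempty (Flag (LowerSet P)) := inferInstance
  rw [← ncard_flag M, ← Nat.card_eq_fintype_card, ← Set.ncard_univ]
  exact Set.ncard_le_ncard (Set.subset_univ _)

variable (P)

theorem hasCodim_hibiIdeal : HasCodim (hibiIdeal k (LowerSet P))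
    (Fintype.card (LowerSet P) - (Nat.card P + 1)) := by
  rw [HasCodim, ringKrullDim_hibiRing_eq, MvPolynomial.ringKrullDim_of_isNoetherianRing,
    ringKrullDim_eq_zero_of_field, zero_add, Nat.card_eq_fintype_card (α := LowerSet P)]
  have h := card_le_card_lowerSet (P := P)
  have : ((Nat.card P + 1 + (Fintype.card (LowerSet P) - (Nat.card P + 1)) : ℕ) : WithBot ℕ∞) =
      (Fintype.card (LowerSet P) : ℕ) := by
    rw [Nat.add_sub_cancel' h]
  rw [← this]
  push_cast
  rfl

variable {P}

open Classical in
theorem isMultidegreePolynomial_hibiIdeal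
    (hw : IsHibiWeight fun α => (Finsupp.single (j α) 1 : τ →₀ ℕ)) :
    IsMultidegreePolynomial (fun α => Finsupp.single (j α) 1) (hibiIdeal k (LowerSet P))
      (∑ s ∈ chainFinset P with s.card = Nat.card P + 1,
        monomial (∑ α ∈ sᶜ, Finsupp.single (j α) 1) (1 : ℤ)) :=
  ⟨_, _, isKPolynomial_hibiKPolynomial k hw (finite_weight_single_eq j), hasCodim_hibiIdeal P k,
    (homogeneousComponent_hibiKPolynomial card_le_card_lowerSet).symm⟩

end KPolynomial

/-! ### Hilbert polynomial and degree -/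

section Degree

/-- Subtracting the indicator `o` of `s` leaves arbitrary exponents on `s` of total q - |s|; then
stars and bars. -/
theorem ncard_support_eq {ι : Type*} {s : Finset ι} (hs : s.Nonempty) {q : ℕ}
    (hq : s.card ≤ q) :
    {u : ι →₀ ℕ | u.support = s ∧ Finsupp.weight (fun _ => (1 : ℕ)) u = q}.ncard =
      (q - s.card + (s.card - 1)).choose (s.card - 1) := by
  classical
  let o : ι →₀ ℕ := ∑ i ∈ s, Finsupp.single i 1
  have ho : ∀ i, o i = if i ∈ s then 1 else 0 := by
    intro i
    simp [o, Finsupp.finsetSum_apply, Finsupp.single_apply]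
  have hsum : ∀ u : ι →₀ ℕ, u.support ⊆ s →
      Finsupp.weight (fun _ => (1 : ℕ)) u = ∑ i ∈ s, u i := by
    intro u hu
    rw [Finsupp.weight_apply, Finsupp.sum_of_support_subset _ hu _ (by simp)]
    simp
  have hos : o.support ⊆ s := by
    intro i hi
    by_contra h
    simp [ho, h] at hi
  have how : Finsupp.weight (fun _ => (1 : ℕ)) o = s.card := by
    rw [hsum _ hos, Finset.card_eq_sum_ones]
    exact Finset.sum_congr rfl fun i hi => by simp [ho, hi]
  have himg : {u : ι →₀ ℕ | u.support = s ∧ Finsupp.weight (fun _ => (1 : ℕ)) u = q} =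
      (fun u => u + o) '' (s.finsuppAntidiag (q - s.card) : Set (ι →₀ ℕ)) := by
    ext u
    simp only [Set.mem_image, Finset.mem_coe, Finset.mem_finsuppAntidiag, Set.mem_ofPred_eq]
    constructor
    · rintro ⟨hu, huq⟩
      have hle : o ≤ u := by
        intro i
        rw [ho]
        split_ifs with hi
        · rw [← hu, Finsupp.mem_support_iff] at hi
          omega
        · exact Nat.zero_le _
      obtain ⟨v, rfl⟩ := exists_add_of_le hle
      have hv : v.support ⊆ s := by
        intro i hi
        rw [← hu]
        simp only [Finsupp.mem_support_iff, Finsupp.add_apply] at hi ⊢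
        omega
      refine ⟨v, ⟨?_, hv⟩, add_comm _ _⟩
      rw [map_add, how, hsum v hv] at huq
      exact (by omega : ∑ i ∈ s, v i = q - s.card)
    · rintro ⟨v, ⟨hvq, hv⟩, rfl⟩
      constructor
      · ext i
        by_cases hi : i ∈ s
        · simp [ho, hi]
        · have hvi : v i = 0 := by
            by_contra h
            exact hi (hv (by simpa using h))
          simp [ho, hi, hvi]
      · rw [map_add, how, hsum v hv, hvq]
        omega
  rw [himg, Set.ncard_image_of_injective _ (add_left_injective _), Set.ncard_coe_finset,
    Finset.card_finsuppAntidiag_nat_eq_choose]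
  have := hs.card_pos
  rw [show s.card + (q - s.card) - 1 = q - s.card + (s.card - 1) by omega]
  exact Nat.choose_symm_of_eq_add rfl

variable (P : Type*) [PartialOrder P] [Finite P] [Fintype (LowerSet P)]

open Classical in
/-- The Hilbert polynomial of the Hibi ring. -/
noncomputable def hibiHilbertPolynomial : Polynomial ℚ :=
  -- Each summand interpolates the count of degree q monomials with support `s`. The empty chain
  -- contributes only in degree 0, so it is left out.
  ∑ s ∈ chainFinset P with s.Nonempty, Polynomial.preHilbertPoly ℚ (s.card - 1) s.card

theorem eval_hibiHilbertPolynomial (k : Type*) [Field k] {q : ℕ} (hq : Nat.card P + 1 ≤ q) :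
    (hibiHilbertPolynomial P).eval (q : ℚ) =
      hilbertFunction (fun _ : LowerSet P => (1 : ℕ)) (hibiIdeal k (LowerSet P)) q := by
  classical
  have hfin : {u : LowerSet P →₀ ℕ | Finsupp.weight (fun _ => (1 : ℕ)) u = q}.Finite := by
    refine (Finsupp.finite_of_degree_le q).subset ?_
    rintro u rfl
    simp [Finsupp.weight_apply, Finsupp.sum, Finsupp.degree_apply]
  rw [hilbertFunction_hibiIdeal k (fun _ _ => rfl) q (hfin.subset fun u hu => hu.2),
    ncard_isStandard hfin, hibiHilbertPolynomial, Polynomial.eval_finsetSum, Nat.cast_sum,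
    Finset.sum_filter]
  refine Finset.sum_congr rfl fun s hs => ?_
  split_ifs with h
  · have := card_le_of_mem_chainFinset hs
    rw [ncard_support_eq h (by omega), Polynomial.preHilbertPoly_eq_choose_sub_add _ _ (by omega)]
  · rw [Finset.not_nonempty_iff_eq_empty] at h
    subst h
    have : {u : LowerSet P →₀ ℕ | u.support = ∅ ∧ Finsupp.weight (fun _ => (1 : ℕ)) u = q} = ∅ := by
      rw [Set.eq_empty_iff_forall_notMem]
      rintro u ⟨hu, huq⟩
      rw [Finsupp.support_eq_empty] at hu
      subst hu
      simp at huq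
      omega
    rw [this]
    simp

theorem natDegree_hibiHilbertPolynomial_le :
    (hibiHilbertPolynomial P).natDegree ≤ Nat.card P := by
  classical
  refine Polynomial.natDegree_sum_le_of_forall_le _ _ fun s hs => ?_
  rw [Polynomial.natDegree_preHilbertPoly]
  have := card_le_of_mem_chainFinset (Finset.mem_filter.1 hs).1
  omega

/-- A chain of r elements contributes a polynomial of degree r - 1 with leading coefficient 1/(r -
1)!, so only the maximal chains reach degree |P|. -/
theorem coeff_hibiHilbertPolynomial :
    (hibiHilbertPolynomial P).coeff (Nat.card P) =
      Nat.card (Flag (LowerSet P)) * ((Nat.card P).factorial : ℚ)⁻¹ := by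
  classical
  rw [hibiHilbertPolynomial, Polynomial.finsetSum_coeff, natCard_flag, ← nsmul_eq_mul,
    ← Finset.sum_const, Finset.sum_filter, Finset.sum_filter]
  refine Finset.sum_congr rfl fun s hs => ?_
  have hle := card_le_of_mem_chainFinset hs
  by_cases hc : s.card = Nat.card P + 1
  · have hne : s.Nonempty := Finset.card_pos.1 (by omega)
    rw [if_pos hne, if_pos hc, hc]
    exact Polynomial.coeff_preHilbertPoly_self _ _ _
  · rw [if_neg hc]
    split_ifs with hne
    · have := hne.card_pos
      refine Polynomial.coeff_eq_zero_of_natDegree_lt ?_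
      rw [Polynomial.natDegree_preHilbertPoly]
      omega
    · rfl

theorem hasDegree_hibiIdeal (k : Type*) [Field k] :
    HasDegree (hibiIdeal k (LowerSet P)) (Nat.card (Flag (LowerSet P))) := by
  have hfac : ((Nat.card P).factorial : ℚ) ≠ 0 := by positivity
  have hN : (Nat.card (Flag (LowerSet P)) : ℚ) ≠ 0 := by
    exact_mod_cast (natCard_flag_pos (P := P)).ne'
  have hdeg : (hibiHilbertPolynomial P).natDegree = Nat.card P := by
    refine le_antisymm (natDegree_hibiHilbertPolynomial_le P)
      (Polynomial.le_natDegree_of_ne_zero ?_)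
    rw [coeff_hibiHilbertPolynomial]
    exact mul_ne_zero hN (inv_ne_zero hfac)
  refine ⟨hibiHilbertPolynomial P, ?_, ?_, ?_⟩
  · filter_upwards [Filter.eventually_ge_atTop (Nat.card P + 1)] with q hq
    exact eval_hibiHilbertPolynomial P k hq
  · rw [hdeg, ringKrullDim_hibiRing_eq]
  · rw [Polynomial.leadingCoeff, hdeg, coeff_hibiHilbertPolynomial]
    field_simp

end Degree

/-! ### The grading attached to a chain -/

section ChainDegree

variable {P : Type*} [PartialOrder P] {l : ℕ}

theorem inter_range_subset_or_subset (c : Fin l ↪o P) (α β : LowerSet P) :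
    (α : Set P) ∩ Set.range c ⊆ β ∨ (β : Set P) ∩ Set.range c ⊆ α := by
  by_contra! h
  obtain ⟨⟨x, ⟨hxα, i, rfl⟩, hxβ⟩, ⟨y, ⟨hyβ, j, rfl⟩, hyα⟩⟩ :=
    And.imp Set.not_subset.1 Set.not_subset.1 h
  rcases le_total i j with hij | hij
  · exact hxβ (β.lower (c.monotone hij) hyβ)
  · exact hyα (α.lower (c.monotone hij) hxα)

/-- Since the traces of α and β on C are nested, the meet has the smaller trace and the join the
larger one. -/
theorem isHibiWeight_chainDegree (c : Fin l ↪o P) {m : ℕ} (f : initialSegments c → Fin (m + 1)) :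
    IsHibiWeight (chainDegree c f) := by
  have key : ∀ α β : LowerSet P, (α : Set P) ∩ Set.range c = (β : Set P) ∩ Set.range c →
      chainDegree c f α = chainDegree c f β := by
    intro α β h
    simp only [chainDegree, h]
  intro α β
  rcases inter_range_subset_or_subset c α β with h | h
  · rw [key (α ⊓ β) α, key (α ⊔ β) β]
    · rw [LowerSet.coe_sup]; grind
    · rw [LowerSet.coe_inf]; grind
  · rw [key (α ⊓ β) β, key (α ⊔ β) α]
    · exact add_comm _ _
    · rw [LowerSet.coe_sup]; grind
    · rw [LowerSet.coe_inf]; grind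

end ChainDegree

end HibiMultidegree

open HibiMultidegree MvPolynomial in
theorem corollary4p4 {k : Type*} [Field k] {P : Type*} [PartialOrder P] [Finite P]
    {l : ℕ} (c : Fin l ↪o P) :
    (∀ (m : ℕ) (f : initialSegments c → Fin (m + 1)),
      IsHomogeneousIdeal (chainDegree c f) (hibiIdeal k (LowerSet P)) ∧
      IsMultidegreePolynomial (chainDegree c f) (hibiIdeal k (LowerSet P))
        (∑ᶠ M : Flag (LowerSet P),
          monomial (∑ᶠ α ∈ (M : Set (LowerSet P))ᶜ, chainDegree c f α) (1 : ℤ))) ∧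
    (∀ f : initialSegments c → Fin (0 + 1),
      ∃ d : ℕ, HasCodim (hibiIdeal k (LowerSet P)) d ∧
        IsMultidegreePolynomial (chainDegree c f) (hibiIdeal k (LowerSet P))
          (monomial (Finsupp.single 0 d) (Nat.card (Flag (LowerSet P)) : ℤ))) ∧
    0 < Nat.card (Flag (LowerSet P)) ∧
    HasDegree (hibiIdeal k (LowerSet P)) (Nat.card (Flag (LowerSet P))) := by
  classical
  have := Fintype.ofFinite (LowerSet P)
  refine ⟨fun m f => ⟨isHomogeneousIdeal_hibiIdeal k (isHibiWeight_chainDegree c f), ?_⟩,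
    fun f => ⟨_, hasCodim_hibiIdeal P k, ?_⟩, natCard_flag_pos, hasDegree_hibiIdeal P k⟩
  · rw [finsum_flag fun s => monomial (∑ᶠ α ∈ sᶜ, chainDegree c f α) (1 : ℤ)]
    simp only [← Finset.coe_compl, finsum_mem_coe_finset]
    exact isMultidegreePolynomial_hibiIdeal k (isHibiWeight_chainDegree c f)
  -- For m = 0 every variable has degree e_0, so each maximal chain gives the same monomial and the
  -- sum counts the chains.
  · have hterm : ∀ s ∈ (chainFinset P).filter fun s => s.card = Nat.card P + 1,
        monomial (∑ α ∈ sᶜ, chainDegree c f α) (1 : ℤ) =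
          monomial (Finsupp.single 0 (Fintype.card (LowerSet P) - (Nat.card P + 1))) 1 := by
      intro s hs
      have hdeg : ∀ α, chainDegree c f α = Finsupp.single 0 1 := fun α =>
        congrArg (Finsupp.single · 1) (Subsingleton.elim (α := Fin 1) _ _)
      simp only [hdeg, Finset.sum_const, Finset.card_compl, (Finset.mem_filter.1 hs).2]
      simp
    have h := isMultidegreePolynomial_hibiIdeal k (isHibiWeight_chainDegree c f)
    have hsum := Finset.sum_congr rfl hterm
    rw [Finset.sum_const, ← natCard_flag, ← map_nsmul, nsmul_eq_mul, mul_one] at hsum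
    exact hsum ▸ h
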